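/- Let $M = 2^{\lambda}$ with $\lambda \ge 1$ an integer, let $\mathcal{S} = \{e^{j(2k+1)\pi/M} : 0 \le k \le M-1\}$ be the $M$-PSK signal set, and let $\Delta\mathcal{S} = \{s - s' : s, s' \in \mathcal{S}\}$. For $\Delta x = [\Delta x_A^T \; \Delta x_B^T]^T$ with $\Delta x_A \in \Delta\mathcal{S}^{n_A}$ and $\Delta x_B \in \Delta\mathcal{S}^{n_B}$ put $[\mathrm{span}(\Delta x)]^{\perp} = \{x \in \mathbb{C}^{n_A+n_B} : x^T v = 0 \text{ for all } v \in \mathrm{span}(\Delta x)\}$; these subspaces are called the singular fade subspaces. A singular fade subspace is called non-removable if it is of the form $[\mathrm{span}(\Delta x)]^{\perp}$ with $\Delta x_A = 0$ or $\Delta x_B = 0$, it is called trivial if it is $[\mathrm{span}(0)]^{\perp}$, and it is called removable if it is not non-removable (that is, if it is $[\mathrm{span}(\Delta x)]^{\perp}$ with $\Delta x_A \ne 0$ and $\Delta x_B \ne 0$). Then the following hold, where $\binom{a}{b} = 0$ for $b > a$. (1) The number of non-trivial non-removable singular fade subspaces is $$\sum_{k=1}^{n_A} \binom{n_A}{k}\left[\left(\tfrac{M}{2}\right)^{k}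 - \tfrac{M}{2} + 1\right]M^{k-1} + \sum_{l=1}^{n_B} \binom{n_B}{l}\left[\left(\tfrac{M}{2}\right)^{l} - \tfrac{M}{2} + 1\right]M^{l-1}.$$ (2) For every $k$ with $2 \le k \le n_A + n_B$, the number of removable singular fade subspaces of the form $[\mathrm{span}(\Delta x)]^{\perp}$ with exactly $k$ non-zero components in $\Delta x$ is $$\left[\binom{n_A+n_B}{k} - \binom{n_A}{k} - \binom{n_B}{k}\right]\left[\left(\tfrac{M}{2}\right)^{k} - \tfrac{M}{2} + 1\right]M^{k-1}.$$ (3) The total number of removable singular fade subspaces is $$\sum_{k=2}^{n_A+n_B}\left[\binom{n_A+n_B}{k} - \binom{n_A}{k} - \binom{n_B}{k}\right]\left[\left(\tfrac{M}{2}\right)^{k} - \tfrac{M}{2} + 1\right]M^{k-1}.$$ -/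

import Mathlib

namespace TwoWayRelay

/-- The symmetric `M`-PSK signal set: the points `e^{j(2k+1)π/M}`, `0 ≤ k ≤ M - 1`. -/
def pskSet (M : ℕ) : Set ℂ :=
  {s | ∃ k : ℕ, k < M ∧ s = Complex.exp (Complex.I * ((2 * k + 1) * Real.pi / M))}

/-- The difference constellation `ΔS = {s - s' : s, s' ∈ S}` of a signal set `S`. -/
def diffSet (S : Set ℂ) : Set ℂ :=
  {d | ∃ s ∈ S, ∃ s' ∈ S, d = s - s'}

/-- The stacked difference vectors `Δx = [Δx_Aᵀ Δx_Bᵀ]ᵀ` with `Δx_A ∈ ΔS^{n_A}` and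
`Δx_B ∈ ΔS^{n_B}`.  The index `Sum.inl i` is the `i`-th coordinate of the `A`-part and
`Sum.inr j` the `j`-th coordinate of the `B`-part. -/
def diffVectors (S : Set ℂ) (nA nB : ℕ) : Set (Fin nA ⊕ Fin nB → ℂ) :=
  {Δx | ∀ i, Δx i ∈ diffSet S}

/-- The part `Δx_A` of a stacked vector. -/
def partA {nA nB : ℕ} (Δx : Fin nA ⊕ Fin nB → ℂ) : Fin nA → ℂ := fun i => Δx (Sum.inl i)

/-- The part `Δx_B` of a stacked vector. -/
def partB {nA nB : ℕ} (Δx : Fin nA ⊕ Fin nB → ℂ) : Fin nB → ℂ := fun j => Δx (Sum.inr j)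

/-- The subspace `[span(Δx)]^⊥ = {x : xᵀ v = 0 for all v ∈ span(Δx)}` of `ℂ^{n_A+n_B}`.
The pairing is the bilinear one, without conjugation. -/
noncomputable def fadeSubspace {nA nB : ℕ} (Δx : Fin nA ⊕ Fin nB → ℂ) :
    Submodule ℂ (Fin nA ⊕ Fin nB → ℂ) :=
  (Submodule.span ℂ {Δx}).orthogonalBilin (dotProductBilin ℂ ℂ)

/-- The set of all singular fade subspaces, `{[span(Δx)]^⊥ : Δx ∈ ΔS^{n_A+n_B}}`. -/
def singularFadeSubspaces (S : Set ℂ) (nA nB : ℕ) :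
    Set (Submodule ℂ (Fin nA ⊕ Fin nB → ℂ)) :=
  {f | ∃ Δx ∈ diffVectors S nA nB, f = fadeSubspace Δx}

/-- The non-removable singular fade subspaces: those of the form `[span(Δx)]^⊥` with
`Δx = [0 Δx_B]` or `Δx = [Δx_A 0]`. -/
def nonRemovable (S : Set ℂ) (nA nB : ℕ) : Set (Submodule ℂ (Fin nA ⊕ Fin nB → ℂ)) :=
  {f | ∃ Δx ∈ diffVectors S nA nB, (partA Δx = 0 ∨ partB Δx = 0) ∧ f = fadeSubspace Δx}

/-- The non-removable singular fade subspaces other than the trivial one, which is the one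
of `Δx = 0`. -/
def nontrivialNonRemovable (S : Set ℂ) (nA nB : ℕ) :
    Set (Submodule ℂ (Fin nA ⊕ Fin nB → ℂ)) :=
  {f | f ∈ nonRemovable S nA nB ∧ f ≠ fadeSubspace 0}

/-- The removable singular fade subspaces: those which are not non-removable. -/
def removable (S : Set ℂ) (nA nB : ℕ) : Set (Submodule ℂ (Fin nA ⊕ Fin nB → ℂ)) :=
  {f | f ∈ singularFadeSubspaces S nA nB ∧ f ∉ nonRemovable S nA nB}

/-- The removable singular fade subspaces of the form `[span(Δx)]^⊥`, `Δx ∈ ΔS^{n_A+n_B}`,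
with exactly `k` non-zero components in `Δx`. -/
def removableOfWeight (S : Set ℂ) (nA nB k : ℕ) :
    Set (Submodule ℂ (Fin nA ⊕ Fin nB → ℂ)) :=
  {f | f ∈ removable S nA nB ∧
    ∃ Δx ∈ diffVectors S nA nB, {i | Δx i ≠ 0}.ncard = k ∧ f = fadeSubspace Δx}

end TwoWayRelay

namespace TwoWayRelay

/-! A fade subspace determines its vector exactly up to a non-zero scalar
(`exists_smul_of_fadeSubspace_eq`), so the task is to count difference vectors up to
proportionality. Support is invariant under scaling, so the count splits over supports `T`.

Write M = 2H. Each non-zero difference is one of H chords times an M-th root of unity, with modulus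
2 sin(πm/M), 1 ≤ m ≤ H. If two vectors with support `T` are proportional, cross-multiplying moduli
gives sin·sin = sin·sin for every pair of coordinates. The arithmetic core, `sin_mul_sin_inj`, says
that such a product determines its unordered pair of factors when M is a power of 2. Hence
proportional vectors have the same moduli, or both have constant moduli. The H constant patterns
merge into one, leaving H^k - H + 1 patterns for |T| = k; a common rotation normalizes one phase,
leaving M^(k-1) phase choices.

The sine statement becomes an identity between differences of cosines, hence a rational relation
among powers of a primitive 2M-th root of unity; the first M powers are independent because φ(2M) =
M.

Finally, non-removable means that the support lies in one of the two blocks, and summing over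
supports by size yields the binomial coefficients. -/

/-! ### Rational relations between cosines -/

lemma coeff_eq_zero_of_sum_pow_eq_zero {lam : ℕ} {ζ : ℂ}
    (hζ : IsPrimitiveRoot ζ (2 ^ (lam + 1))) (c : ℕ → ℚ)
    (h : ∑ k ∈ Finset.range (2 ^ lam), (c k : ℂ) * ζ ^ k = 0) :
    ∀ k < 2 ^ lam, c k = 0 := by
  set P : Polynomial ℚ := ∑ k ∈ Finset.range (2 ^ lam), Polynomial.monomial k (c k) with hP
  have hcoeff : ∀ k < 2 ^ lam, P.coeff k = c k := by
    intro k hk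
    simp [hP, Polynomial.finsetSum_coeff, Polynomial.coeff_monomial, hk]
  have heval : Polynomial.aeval ζ P = 0 := by
    simpa [hP, Polynomial.aeval_monomial] using h
  -- The minimal polynomial is cyclotomic, of degree φ(2^(lam+1)) = 2^lam, too large to divide a
  -- non-zero `P`.
  have hmin : (minpoly ℚ ζ).natDegree = 2 ^ lam := by
    rw [← Polynomial.cyclotomic_eq_minpoly_rat hζ (by positivity),
      Polynomial.natDegree_cyclotomic, Nat.totient_prime_pow_succ Nat.prime_two]
    simp
  have hdeg : P.degree < (2 ^ lam : ℕ) := by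
    refine lt_of_le_of_lt (Polynomial.degree_sum_le _ _) ?_
    rw [Finset.sup_lt_iff (WithBot.bot_lt_coe _)]
    intro k hk
    refine lt_of_le_of_lt (Polynomial.degree_monomial_le _ _) ?_
    exact_mod_cast Finset.mem_range.1 hk
  have hP0 : P = 0 := by
    by_contra hne
    have h1 := minpoly.degree_le_of_ne_zero ℚ ζ hne heval
    rw [Polynomial.degree_eq_natDegree (minpoly.ne_zero
      (hζ.isIntegral (by positivity)).tower_top), hmin] at h1
    exact absurd (lt_of_le_of_lt h1 hdeg) (lt_irrefl _)
  intro k hk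
  rw [← hcoeff k hk, hP0, Polynomial.coeff_zero]

/-- The coefficients of `2 cos (π n / M)`, `0 ≤ n ≤ M`, in the powers of `exp (I π / M)`. -/
def cosCoeff (M n k : ℕ) : ℤ :=
  (if k = n then 1 else 0) + (if k = 0 ∧ n = 0 then 1 else 0)
    - (if k = M - n then 1 else 0) - (if k = 0 ∧ n = M then 1 else 0)

/-- With ζ = exp(iπ/M), ζ^M = -1 turns ζ^n + ζ^(-n) into ζ^n - ζ^(M-n). At n = 0 or n = M one
exponent equals M and leaves the range; the extra terms of `cosCoeff` at k = 0 compensate. -/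
lemma sum_cosCoeff {M n : ℕ} (hM : 0 < M) (hn : n ≤ M) :
    ∑ k ∈ Finset.range M, ((cosCoeff M n k : ℚ) : ℂ) *
      Complex.exp (Complex.I * (Real.pi / M)) ^ k = ((2 * Real.cos (Real.pi * n / M) : ℝ) : ℂ) := by
  have hM' : (M : ℂ) ≠ 0 := by exact_mod_cast hM.ne'
  rcases Nat.eq_zero_or_pos n with rfl | hn0
  · rw [Finset.sum_eq_single 0]
    · simp [cosCoeff, hM.ne]
    · intro b hb hb0
      have := Finset.mem_range.1 hb
      simp [cosCoeff, hb0, this.ne]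
    · intro h; exact absurd (Finset.mem_range.2 hM) h
  rcases hn.eq_or_lt with rfl | hn1
  · have hr : Real.pi * (n : ℝ) / n = Real.pi := by
      field_simp
    rw [Finset.sum_eq_single 0, hr]
    · simp [cosCoeff, hM.ne, hM.ne']
    · intro b hb hb0
      have := Finset.mem_range.1 hb
      simp [cosCoeff, hb0, this.ne]
    · intro h; exact absurd (Finset.mem_range.2 hM) h
  · have hc : ∀ k, ((cosCoeff M n k : ℚ) : ℂ) =
        (if k = n then 1 else 0) - (if k = M - n then 1 else 0) := by
      intro k
      have : cosCoeff M n k = (if k = n then 1 else 0) - (if k = M - n then 1 else 0) := by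
        unfold cosCoeff; split_ifs <;> omega
      rw [this]
      split_ifs <;> simp
    have h1 : M - n < M := by omega
    simp only [hc, sub_mul, ite_mul, one_mul, zero_mul, Finset.sum_sub_distrib,
      Finset.sum_ite_eq', Finset.mem_range, hn1, h1, if_true]
    push_cast
    rw [← Complex.exp_nat_mul, ← Complex.exp_nat_mul, Complex.two_cos]
    have e1 : (n : ℂ) * (Complex.I * (Real.pi / M)) = Real.pi * n / M * Complex.I := by ring
    have e2 : ((M - n : ℕ) : ℂ) * (Complex.I * (Real.pi / M)) =
        -(Real.pi * n / M) * Complex.I + Real.pi * Complex.I := by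
      rw [Nat.cast_sub hn]; field_simp; ring
    rw [e1, e2, Complex.exp_add, Complex.exp_pi_mul_I]
    ring

lemma cosCoeff_eq_of_cos_eq {lam a b c d : ℕ} (ha : a ≤ 2 ^ lam) (hb : b ≤ 2 ^ lam)
    (hc : c ≤ 2 ^ lam) (hd : d ≤ 2 ^ lam)
    (h : Real.cos (Real.pi * a / (2 ^ lam : ℕ)) - Real.cos (Real.pi * b / (2 ^ lam : ℕ)) =
      Real.cos (Real.pi * c / (2 ^ lam : ℕ)) - Real.cos (Real.pi * d / (2 ^ lam : ℕ))) :
    ∀ k < 2 ^ lam, cosCoeff (2 ^ lam) a k - cosCoeff (2 ^ lam) b k =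
      cosCoeff (2 ^ lam) c k - cosCoeff (2 ^ lam) d k := by
  have hpos : 0 < 2 ^ lam := by positivity
  have hζ : IsPrimitiveRoot (Complex.exp (Complex.I * (Real.pi / (2 ^ lam : ℕ))))
      (2 ^ (lam + 1)) := by
    convert Complex.isPrimitiveRoot_exp (2 ^ (lam + 1)) (by positivity) using 2
    push_cast
    field_simp
    ring
  have key := coeff_eq_zero_of_sum_pow_eq_zero hζ
    (fun k => cosCoeff (2 ^ lam) a k - cosCoeff (2 ^ lam) b k -
      (cosCoeff (2 ^ lam) c k - cosCoeff (2 ^ lam) d k)) (by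
      have := congrArg (fun x : ℝ => ((2 * x : ℝ) : ℂ)) h
      simp only [mul_sub] at this
      rw [Complex.ofReal_sub, Complex.ofReal_sub, ← sum_cosCoeff hpos ha, ← sum_cosCoeff hpos hb,
        ← sum_cosCoeff hpos hc, ← sum_cosCoeff hpos hd] at this
      simp only [Rat.cast_sub, sub_mul, Finset.sum_sub_distrib]
      exact sub_eq_zero.2 this)
  intro k hk
  have := key k hk
  exact_mod_cast sub_eq_zero.1 this

/-! ### A product of two sines determines its factors -/

lemma eq_of_cosCoeff_pos {M n k : ℕ} (h : 0 < cosCoeff M n k) : k = n := by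
  unfold cosCoeff at h
  split_ifs at h <;> omega

lemma eq_sub_of_cosCoeff_neg {M n k : ℕ} (h : cosCoeff M n k < 0) : k = M - n := by
  unfold cosCoeff at h
  split_ifs at h <;> omega

lemma cosCoeff_self_pos {M n : ℕ} (h : 2 * n < M) : 0 < cosCoeff M n n := by
  unfold cosCoeff
  split_ifs <;> omega

lemma cosCoeff_sub_neg {M n : ℕ} (h : M < 2 * n) (h' : n ≤ M) : cosCoeff M n (M - n) < 0 := by
  unfold cosCoeff
  split_ifs <;> omega

/-- The sign and position of a non-zero coefficient reveal the index. Only 2m = M, where the cosine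
vanishes, gives no such coefficient. -/
lemma eq_of_forall_cosCoeff_eq {M m n : ℕ} (hm : m ≤ M) (hn : n ≤ M)
    (h : ∀ k < M, cosCoeff M m k = cosCoeff M n k) : m = n := by
  have aux : ∀ m n : ℕ, m ≤ M → n ≤ M → (∀ k < M, cosCoeff M m k = cosCoeff M n k) →
      2 * m ≠ M → m = n := by
    intro m n hm hn h hne
    rcases lt_or_gt_of_ne hne with h1 | h1
    · exact eq_of_cosCoeff_pos (h m (by omega) ▸ cosCoeff_self_pos h1)
    · have := eq_sub_of_cosCoeff_neg (h (M - m) (by omega) ▸ cosCoeff_sub_neg h1 hm)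
      omega
  by_cases h1 : 2 * m = M
  · by_cases h2 : 2 * n = M
    · omega
    · exact (aux n m hn hm (fun k hk => (h k hk).symm) h2).symm
  · exact aux m n hm hn h h1

lemma eq_of_cosCoeff_eq {H a b c d : ℕ} (hd : 1 ≤ d) (hda : d ≤ a) (ha : a ≤ H)
    (hc : 1 ≤ c) (hcb : c ≤ b) (hb : b ≤ H)
    (h : ∀ k < 2 * H, cosCoeff (2 * H) (a - d) k - cosCoeff (2 * H) (a + d) k =
      cosCoeff (2 * H) (b - c) k - cosCoeff (2 * H) (b + c) k) : a = b ∧ d = c := by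
  -- The left side is positive at k = m, so the right side must be too: either `p` contributes its
  -- positive term there or `q` its negative one.
  have aux : ∀ m n p q : ℕ, 2 * m < 2 * H → m < n →
      cosCoeff (2 * H) m m - cosCoeff (2 * H) n m = cosCoeff (2 * H) p m - cosCoeff (2 * H) q m →
      m = p ∨ m = 2 * H - q := by
    intro m n p q hm hmn h
    have h1 := cosCoeff_self_pos hm
    have h2 : cosCoeff (2 * H) n m ≤ 0 := not_lt.1 fun h' => hmn.ne (eq_of_cosCoeff_pos h')
    by_contra! hne
    have h3 : cosCoeff (2 * H) p m ≤ 0 := not_lt.1 fun h' => hne.1 (eq_of_cosCoeff_pos h')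
    have h4 : 0 ≤ cosCoeff (2 * H) q m := not_lt.1 fun h' => hne.2 (eq_sub_of_cosCoeff_neg h')
    linarith
  have h1 := aux (a - d) (a + d) (b - c) (b + c) (by omega) (by omega) (h _ (by omega))
  have h2 := aux (b - c) (b + c) (a - d) (a + d) (by omega) (by omega) (h _ (by omega)).symm
  -- If both alternatives were the crossed ones, adding them would give a + b = 2H, hence a = b = H
  -- and d = c, so the equality holds anyway.
  have e1 : a - d = b - c := by omega
  have e2 : a + d = b + c := eq_of_forall_cosCoeff_eq (M := 2 * H) (by omega) (by omega) (by
    intro k hk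
    have := h k hk
    rw [e1] at this
    linarith)
  omega

lemma sin_mul_sin_inj_of_le {lam a b c d : ℕ} (hd : 1 ≤ d) (hda : d ≤ a) (ha : a ≤ 2 ^ lam)
    (hc : 1 ≤ c) (hcb : c ≤ b) (hb : b ≤ 2 ^ lam)
    (h : Real.sin (Real.pi * a / (2 ^ (lam + 1) : ℕ)) * Real.sin (Real.pi * d / (2 ^ (lam + 1) : ℕ)) =
      Real.sin (Real.pi * b / (2 ^ (lam + 1) : ℕ)) * Real.sin (Real.pi * c / (2 ^ (lam + 1) : ℕ))) :
    a = b ∧ d = c := by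
  have hprod : ∀ m n : ℕ, n ≤ m → Real.cos (Real.pi * (m - n : ℕ) / (2 ^ (lam + 1) : ℕ)) -
      Real.cos (Real.pi * (m + n : ℕ) / (2 ^ (lam + 1) : ℕ)) =
      2 * (Real.sin (Real.pi * m / (2 ^ (lam + 1) : ℕ)) *
        Real.sin (Real.pi * n / (2 ^ (lam + 1) : ℕ))) := by
    intro m n hmn
    rw [Nat.cast_sub hmn, Nat.cast_add, mul_sub, mul_add, sub_div, add_div, Real.cos_sub,
      Real.cos_add]
    ring
  have h2 : 2 ^ (lam + 1) = 2 * 2 ^ lam := by ring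
  have := cosCoeff_eq_of_cos_eq (lam := lam + 1) (a := a - d) (b := a + d) (c := b - c) (d := b + c)
    (by omega) (by omega) (by omega) (by omega) (by rw [hprod a d hda, hprod b c hcb, h])
  rw [h2] at this
  exact eq_of_cosCoeff_eq hd hda ha hc hcb hb this

lemma sin_mul_sin_inj {lam a b c d : ℕ} (ha1 : 1 ≤ a) (ha : a ≤ 2 ^ lam) (hb1 : 1 ≤ b)
    (hb : b ≤ 2 ^ lam) (hc1 : 1 ≤ c) (hc : c ≤ 2 ^ lam) (hd1 : 1 ≤ d) (hd : d ≤ 2 ^ lam)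
    (h : Real.sin (Real.pi * a / (2 ^ (lam + 1) : ℕ)) * Real.sin (Real.pi * d / (2 ^ (lam + 1) : ℕ)) =
      Real.sin (Real.pi * b / (2 ^ (lam + 1) : ℕ)) * Real.sin (Real.pi * c / (2 ^ (lam + 1) : ℕ))) :
    (a = b ∧ d = c) ∨ (a = c ∧ d = b) := by
  rcases le_total d a with h1 | h1 <;> rcases le_total c b with h2 | h2
  · exact Or.inl (sin_mul_sin_inj_of_le hd1 h1 ha hc1 h2 hb h)
  · exact Or.inr (sin_mul_sin_inj_of_le hd1 h1 ha hb1 h2 hc (by rw [h, mul_comm]))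
  · exact Or.inr (sin_mul_sin_inj_of_le ha1 h1 hd hc1 h2 hb (by rw [← h, mul_comm])).symm
  · exact Or.inl (sin_mul_sin_inj_of_le ha1 h1 hd hb1 h2 hc
      (by rw [mul_comm, h, mul_comm])).symm

/-! ### Fade subspaces and proportionality -/

lemma mem_fadeSubspace {nA nB : ℕ} {x v : Fin nA ⊕ Fin nB → ℂ} :
    v ∈ fadeSubspace x ↔ x ⬝ᵥ v = 0 := by
  unfold fadeSubspace
  rw [Submodule.mem_orthogonalBilin_iff]
  constructor
  · intro h
    exact h x (Submodule.mem_span_singleton_self x)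
  · intro h n hn
    obtain ⟨c, rfl⟩ := Submodule.mem_span_singleton.1 hn
    change (c • x) ⬝ᵥ v = 0
    rw [smul_dotProduct, h, smul_zero]

lemma fadeSubspace_smul {nA nB : ℕ} {c : ℂ} (hc : c ≠ 0) (x : Fin nA ⊕ Fin nB → ℂ) :
    fadeSubspace (c • x) = fadeSubspace x := by
  ext v
  simp [mem_fadeSubspace, hc]

lemma exists_smul_of_fadeSubspace_eq {nA nB : ℕ} {x y : Fin nA ⊕ Fin nB → ℂ}
    (h : fadeSubspace x = fadeSubspace y) : ∃ c : ℂ, c ≠ 0 ∧ x = c • y := by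
  have aux : ∀ x y : Fin nA ⊕ Fin nB → ℂ, fadeSubspace x = fadeSubspace y →
      ∃ c : ℂ, x = c • y := by
    intro x y h
    by_cases hy : y = 0
    · refine ⟨0, ?_⟩
      subst hy
      rw [smul_zero]
      funext i
      have : Pi.single i 1 ∈ fadeSubspace x := by
        rw [h, mem_fadeSubspace, zero_dotProduct]
      simpa [mem_fadeSubspace] using this
    · obtain ⟨j, hj⟩ := Function.ne_iff.1 hy
      rw [Pi.zero_apply] at hj
      refine ⟨x j / y j, ?_⟩
      funext i
      -- This vector annihilates y; that it annihilates x is the vanishing of a 2×2 minor.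
      have : y j • Pi.single i 1 - y i • Pi.single j 1 ∈ fadeSubspace x := by
        rw [h, mem_fadeSubspace]
        simp [dotProduct_sub, dotProduct_smul, mul_comm]
      rw [mem_fadeSubspace] at this
      simp only [dotProduct_sub, dotProduct_smul, dotProduct_single_one, smul_eq_mul] at this
      simp only [Pi.smul_apply, smul_eq_mul]
      field_simp
      linear_combination this
  obtain ⟨c, hc⟩ := aux x y h
  by_cases h0 : c = 0
  · obtain ⟨d, hd⟩ := aux y x h.symm
    rw [h0, zero_smul] at hc
    rw [hc, smul_zero] at hd
    exact ⟨1, one_ne_zero, by rw [hc, hd, smul_zero]⟩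
  · exact ⟨c, h0, hc⟩

/-! ### Polar form of the difference constellation -/

/-- The differences `e^{jπ/M} (ω^{n+1} - 1)`, `ω = e^{2πj/M}`: for `n < M / 2` they represent
the distinct moduli of the non-zero elements of the difference constellation of `M`-PSK. -/
noncomputable def chord (M n : ℕ) : ℂ :=
  Complex.exp (Complex.I * (Real.pi / M)) *
    (Complex.exp (2 * Real.pi * Complex.I / M) ^ (n + 1) - 1)

lemma mem_pskSet {M : ℕ} {s : ℂ} : s ∈ pskSet M ↔
    ∃ k < M, s = Complex.exp (Complex.I * (Real.pi / M)) *
      Complex.exp (2 * Real.pi * Complex.I / M) ^ k := by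
  have : ∀ k : ℕ, Complex.exp (Complex.I * ((2 * k + 1) * Real.pi / M)) =
      Complex.exp (Complex.I * (Real.pi / M)) *
      Complex.exp (2 * Real.pi * Complex.I / M) ^ k := by
    intro k
    rw [← Complex.exp_nat_mul, ← Complex.exp_add]
    congr 1
    ring
  simp only [pskSet, Set.mem_ofPred_eq, this]

lemma norm_chord {M n : ℕ} (hn : n + 1 ≤ M) :
    ‖chord M n‖ = 2 * Real.sin (Real.pi * (n + 1 : ℕ) / M) := by
  have h1 : ‖Complex.exp (Complex.I * (Real.pi / M))‖ = 1 := by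
    have := Complex.norm_exp_I_mul_ofReal (Real.pi / M)
    push_cast at this
    exact this
  have h2 : Complex.exp (2 * Real.pi * Complex.I / M) ^ (n + 1) =
      Complex.exp (Complex.I * (2 * (Real.pi * (n + 1 : ℕ) / M) : ℝ)) := by
    rw [← Complex.exp_nat_mul]
    congr 1
    push_cast
    ring
  have hM : (0 : ℝ) < M := by exact_mod_cast (by omega : 0 < M)
  have hle : ((n + 1 : ℕ) : ℝ) ≤ M := by exact_mod_cast hn
  rw [chord, norm_mul, h1, h2, Complex.norm_exp_I_mul_ofReal_sub_one, one_mul,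
    mul_div_cancel_left₀ _ two_ne_zero, Real.norm_of_nonneg]
  refine mul_nonneg zero_le_two (Real.sin_nonneg_of_nonneg_of_le_pi (by positivity) ?_)
  rw [div_le_iff₀ hM]
  gcongr

lemma chord_ne_zero {M n : ℕ} (hn : n + 1 < M) : chord M n ≠ 0 := by
  have h := Complex.isPrimitiveRoot_exp M (by omega)
  exact mul_ne_zero (Complex.exp_ne_zero _)
    (sub_ne_zero.2 (h.pow_ne_one_of_pos_of_lt (Nat.succ_ne_zero n) hn))

lemma zero_mem_diffSet {M : ℕ} (hM : 0 < M) : (0 : ℂ) ∈ diffSet (pskSet M) :=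
  ⟨_, ⟨0, hM, rfl⟩, _, ⟨0, hM, rfl⟩, (sub_self _).symm⟩

lemma chord_mul_mem_diffSet {M n : ℕ} (hM : 0 < M) {u : ℂ} (hu : u ^ M = 1) :
    chord M n * u ∈ diffSet (pskSet M) := by
  have h := Complex.isPrimitiveRoot_exp M hM.ne'
  have : NeZero M := ⟨hM.ne'⟩
  obtain ⟨l, hl, rfl⟩ := h.eq_pow_of_pow_eq_one hu
  refine ⟨_, mem_pskSet.2 ⟨(n + 1 + l) % M, Nat.mod_lt _ hM, rfl⟩, _, mem_pskSet.2 ⟨l, hl, rfl⟩, ?_⟩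
  rw [← pow_eq_pow_mod _ h.pow_eq_one, chord, pow_add]
  ring

lemma exists_chord_of_mem_diffSet {H : ℕ} (hH : 0 < H) {d : ℂ}
    (hd : d ∈ diffSet (pskSet (2 * H))) (hd0 : d ≠ 0) :
    ∃ n < H, ∃ u : ℂ, u ^ (2 * H) = 1 ∧ d = chord (2 * H) n * u := by
  obtain ⟨s, hs, s', hs', rfl⟩ := hd
  obtain ⟨k, hk, rfl⟩ := mem_pskSet.1 hs
  obtain ⟨l, hl, rfl⟩ := mem_pskSet.1 hs'
  have h := Complex.isPrimitiveRoot_exp (2 * H) (by omega)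
  unfold chord
  set e := Complex.exp (Complex.I * (Real.pi / (2 * H : ℕ)))
  set ω := Complex.exp (2 * Real.pi * Complex.I / (2 * H : ℕ))
  have hω : ∀ i, (ω ^ i) ^ (2 * H) = 1 := by
    intro i
    rw [← pow_mul, mul_comm, pow_mul, h.pow_eq_one, one_pow]
  have hneg : ∀ u : ℂ, (-u) ^ (2 * H) = u ^ (2 * H) := fun u => (even_two_mul H).neg_pow u
  have aux : ∀ k l, l < k → k < 2 * H → ∃ n < H, ∃ u : ℂ, u ^ (2 * H) = 1 ∧
      e * ω ^ k - e * ω ^ l = e * (ω ^ (n + 1) - 1) * u := by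
    intro k l hlk hk
    obtain ⟨m, rfl⟩ := Nat.exists_eq_add_of_lt hlk
    rcases lt_or_ge m H with hm | hm
    · refine ⟨m, hm, ω ^ l, hω l, ?_⟩
      rw [add_assoc, pow_add]
      ring
    -- A gap m + 1 > H is replaced by the complementary gap 2H - (m + 1), read from the other
    -- endpoint. The sign is absorbed in the phase, since -1 is a 2H-th root of unity.
    · refine ⟨2 * H - m - 2, by omega, -ω ^ (l + m + 1), by rw [hneg, hω], ?_⟩
      have : ω ^ (2 * H - m - 2 + 1) * ω ^ (l + m + 1) = ω ^ l := by
        rw [← pow_add, (by omega : 2 * H - m - 2 + 1 + (l + m + 1) = 2 * H + l), pow_add,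
          h.pow_eq_one, one_mul]
      linear_combination e * this
  rcases lt_trichotomy k l with hkl | rfl | hkl
  · obtain ⟨n, hn, u, hu, heq⟩ := aux l k hkl hl
    refine ⟨n, hn, -u, by rw [hneg, hu], ?_⟩
    linear_combination -heq
  · exact absurd (sub_self _) hd0
  · exact aux k l hkl hk

lemma norm_chord_mul_inj {lam a b c d : ℕ} (ha : a < 2 ^ lam) (hb : b < 2 ^ lam)
    (hc : c < 2 ^ lam) (hd : d < 2 ^ lam)
    (h : ‖chord (2 * 2 ^ lam) a‖ * ‖chord (2 * 2 ^ lam) d‖ =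
      ‖chord (2 * 2 ^ lam) b‖ * ‖chord (2 * 2 ^ lam) c‖) :
    (a = b ∧ d = c) ∨ (a = c ∧ d = b) := by
  rw [norm_chord (by omega), norm_chord (by omega), norm_chord (by omega),
    norm_chord (by omega), ← pow_succ'] at h
  have := sin_mul_sin_inj (lam := lam) (a := a + 1) (b := b + 1) (c := c + 1) (d := d + 1)
    (by omega) (by omega) (by omega) (by omega) (by omega) (by omega) (by omega) (by omega)
    (by linarith)
  omega

/-! ### Counting for a fixed support -/

/-- The singular fade subspaces of the difference vectors with support `T`. -/
def fadeSubspacesOfSupport (S : Set ℂ) {nA nB : ℕ} (T : Finset (Fin nA ⊕ Fin nB)) :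
    Set (Submodule ℂ (Fin nA ⊕ Fin nB → ℂ)) :=
  {f | ∃ Δx ∈ diffVectors S nA nB, (∀ i, Δx i ≠ 0 ↔ i ∈ T) ∧ f = fadeSubspace Δx}

/-- The vector with support `T`, moduli `n` and phases `u`. -/
noncomputable def chordVector {H M nA nB : ℕ} {T : Finset (Fin nA ⊕ Fin nB)} (n : T → Fin H)
    (u : T → rootsOfUnity M ℂ) : Fin nA ⊕ Fin nB → ℂ :=
  fun i => if h : i ∈ T then chord M (n ⟨i, h⟩) * ((u ⟨i, h⟩ : ℂˣ) : ℂ) else 0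

lemma chordVector_apply {H M nA nB : ℕ} {T : Finset (Fin nA ⊕ Fin nB)} (n : T → Fin H)
    (u : T → rootsOfUnity M ℂ) (t : T) :
    chordVector n u t = chord M (n t) * ((u t : ℂˣ) : ℂ) := by
  simp [chordVector]

lemma chordVector_ne_zero_iff {H nA nB : ℕ} {T : Finset (Fin nA ⊕ Fin nB)}
    (n : T → Fin (2 ^ H)) (u : T → rootsOfUnity (2 * 2 ^ H) ℂ) (i : Fin nA ⊕ Fin nB) :
    chordVector n u i ≠ 0 ↔ i ∈ T := by
  unfold chordVector
  split_ifs with h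
  · have := (n ⟨i, h⟩).2
    simpa [h] using chord_ne_zero (M := 2 * 2 ^ H) (n := n ⟨i, h⟩) (by omega)
  · simp [h]

lemma rootsOfUnity_val_pow {M : ℕ} (u : rootsOfUnity M ℂ) : ((u : ℂˣ) : ℂ) ^ M = 1 := by
  have := (mem_rootsOfUnity M (u : ℂˣ)).1 u.2
  rw [← Units.val_pow_eq_pow_val, this, Units.val_one]

lemma chordVector_mem_diffVectors {H M nA nB : ℕ} (hM : 0 < M) {T : Finset (Fin nA ⊕ Fin nB)}
    (n : T → Fin H) (u : T → rootsOfUnity M ℂ) :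
    chordVector n u ∈ diffVectors (pskSet M) nA nB := by
  intro i
  unfold chordVector
  split_ifs with h
  · exact chord_mul_mem_diffSet hM (rootsOfUnity_val_pow _)
  · exact zero_mem_diffSet hM

/-- The moduli of canonical representatives: non-constant or zero. -/
def normalizedModuli (ι : Type*) [Fintype ι] [DecidableEq ι] (H : ℕ) [NeZero H] :
    Finset (ι → Fin H) :=
  {n | n = 0 ∨ ∃ i j, n i ≠ n j}

lemma card_normalizedModuli {ι : Type*} [Fintype ι] [DecidableEq ι] [Nonempty ι] (H : ℕ)
    [NeZero H] :
    ((normalizedModuli ι H).card : ℚ) = (H : ℚ) ^ Fintype.card ι - H + 1 := by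
  have h1 := Finset.card_filter_add_card_filter_not (s := (Finset.univ : Finset (ι → Fin H)))
    (fun n => n = 0 ∨ ∃ i j, n i ≠ n j)
  -- The excluded patterns are the H - 1 non-zero constants.
  have h2 : Finset.univ.filter (fun n : ι → Fin H => ¬ (n = 0 ∨ ∃ i j, n i ≠ n j)) =
      (Finset.univ.erase (0 : Fin H)).image (Function.const ι) := by
    ext n
    simp only [Finset.mem_filter, Finset.mem_univ, true_and, Finset.mem_image, Finset.mem_erase,
      and_true]
    push Not
    constructor
    · rintro ⟨h0, hc⟩
      have i : ι := Classical.arbitrary ι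
      have hn : Function.const ι (n i) = n := funext fun j => hc i j
      refine ⟨n i, fun h => h0 ?_, hn⟩
      rw [← hn, h]
      rfl
    · rintro ⟨a, ha, rfl⟩
      exact ⟨fun h => ha (congrFun h (Classical.arbitrary ι)), fun _ _ => rfl⟩
  rw [h2, Finset.card_image_of_injective _ Function.const_injective,
    Finset.card_erase_of_mem (Finset.mem_univ _), Finset.card_univ, Finset.card_univ,
    Fintype.card_fun, Fintype.card_fin] at h1
  have hH : 1 ≤ H := NeZero.one_le
  have h3 : (normalizedModuli ι H).card + (H - 1) = H ^ Fintype.card ι := h1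
  have h4 := congrArg (Nat.cast : ℕ → ℚ) h3
  push_cast [Nat.cast_sub hH] at h4
  linarith

/-- Uniqueness of the canonical representative: moduli agree by cross-multiplication and
`norm_chord_mul_inj`, after which the phase fixed at `t₀` forces c = 1. -/
lemma eq_of_chordVector_eq_smul {lam nA nB : ℕ} {T : Finset (Fin nA ⊕ Fin nB)} (t₀ : T)
    {n n' : T → Fin (2 ^ lam)} {u u' : T → rootsOfUnity (2 * 2 ^ lam) ℂ}
    (hn : n ∈ normalizedModuli T (2 ^ lam)) (hn' : n' ∈ normalizedModuli T (2 ^ lam))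
    (hu : u t₀ = 1) (hu' : u' t₀ = 1) {c : ℂ} (h : chordVector n u = c • chordVector n' u') :
    n = n' ∧ u = u' := by
  have happ : ∀ t : T, chord (2 * 2 ^ lam) (n t) * ((u t : ℂˣ) : ℂ) =
      c * (chord (2 * 2 ^ lam) (n' t) * ((u' t : ℂˣ) : ℂ)) := by
    intro t
    rw [← chordVector_apply, ← chordVector_apply, h]
    rfl
  have hnorm : ∀ t : T, ‖chord (2 * 2 ^ lam) (n t)‖ = ‖c‖ * ‖chord (2 * 2 ^ lam) (n' t)‖ := by
    have hu1 : ∀ v : rootsOfUnity (2 * 2 ^ lam) ℂ, ‖((v : ℂˣ) : ℂ)‖ = 1 := fun v =>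
      Complex.norm_eq_one_of_pow_eq_one (rootsOfUnity_val_pow v) (by positivity)
    intro t
    have := congrArg norm (happ t)
    simpa [norm_mul, hu1] using this
  have hcross : ∀ i j : T, (n i = n j ∧ n' j = n' i) ∨ (n i = n' i ∧ n' j = n j) := by
    intro i j
    have := norm_chord_mul_inj (n i).2 (n j).2 (n' i).2 (n' j).2
      (by rw [hnorm i, hnorm j]; ring)
    simpa [Fin.ext_iff] using this
  have hnn : n = n' := by
    simp only [normalizedModuli, Finset.mem_filter, Finset.mem_univ, true_and] at hn hn'
    rcases hn with rfl | ⟨i, j, hij⟩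
    · rcases hn' with rfl | ⟨i, j, hij⟩
      · rfl
      · rcases hcross i j with h | h
        · exact absurd h.2.symm hij
        · exact absurd (h.1.symm.trans h.2.symm) hij
    -- Since n i ≠ n j, the index k can be compared with whichever of i, j has a modulus different
    -- from its own; this rules out the first alternative of `hcross`.
    · funext k
      by_cases hki : n k = n i
      · rcases hcross k j with h | h
        · exact absurd (hki.symm.trans h.1) hij
        · exact h.1
      · rcases hcross k i with h | h
        · exact absurd h.1 hki
        · exact h.1
  subst hnn
  have hcu : ∀ t : T, ((u t : ℂˣ) : ℂ) = c * ((u' t : ℂˣ) : ℂ) := by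
    intro t
    have hlt := (n t).2
    have := happ t
    rw [mul_left_comm] at this
    exact mul_left_cancel₀ (chord_ne_zero (by omega)) this
  have hc : c = 1 := by
    have := hcu t₀
    rw [hu, hu'] at this
    simpa using this.symm
  refine ⟨rfl, funext fun t => Subtype.ext (Units.ext ?_)⟩
  rw [hcu t, hc, one_mul]

/-- Dividing by the phase at `t₀` normalizes the phases. If the moduli are constant, the scalar also
absorbs the ratio of that chord to chord 0. -/
lemma exists_chordVector {lam nA nB : ℕ} {T : Finset (Fin nA ⊕ Fin nB)} (t₀ : T)
    {x : Fin nA ⊕ Fin nB → ℂ} (hx : x ∈ diffVectors (pskSet (2 * 2 ^ lam)) nA nB)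
    (hT : ∀ i, x i ≠ 0 ↔ i ∈ T) :
    ∃ n ∈ normalizedModuli T (2 ^ lam), ∃ u : T → rootsOfUnity (2 * 2 ^ lam) ℂ, u t₀ = 1 ∧
      fadeSubspace x = fadeSubspace (chordVector n u) := by
  have hpos : 0 < 2 ^ lam := by positivity
  have hne : NeZero (2 * 2 ^ lam) := ⟨by positivity⟩
  have hex : ∀ t : T, ∃ (n : Fin (2 ^ lam)) (u : rootsOfUnity (2 * 2 ^ lam) ℂ),
      x t = chord (2 * 2 ^ lam) n * ((u : ℂˣ) : ℂ) := by
    intro t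
    obtain ⟨n, hn, u, hu, h⟩ := exists_chord_of_mem_diffSet hpos (hx t) ((hT t).2 t.2)
    exact ⟨⟨n, hn⟩, rootsOfUnity.mkOfPowEq u hu, by simpa using h⟩
  choose n u hnu using hex
  have hzero : ∀ i ∉ T, x i = 0 := fun i hi => not_not.1 fun h => hi ((hT i).1 h)
  by_cases hc : ∃ i j, n i ≠ n j
  · refine ⟨n, Finset.mem_filter.2 ⟨Finset.mem_univ _, Or.inr hc⟩, fun t => u t / u t₀, div_self' _, ?_⟩
    have : x = ((u t₀ : ℂˣ) : ℂ) • chordVector n (fun t => u t / u t₀) := by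
      funext i
      by_cases hi : i ∈ T
      · have := chordVector_apply n (fun t => u t / u t₀) ⟨i, hi⟩
        dsimp only at this
        rw [Pi.smul_apply, this, hnu ⟨i, hi⟩]
        simp
        field_simp
      · simp [chordVector, hi, hzero i hi]
    rw [this, fadeSubspace_smul (Units.ne_zero _)]
  · push Not at hc
    refine ⟨0, by simp [normalizedModuli], fun t => u t / u t₀, div_self' _, ?_⟩
    have h0 : chord (2 * 2 ^ lam) 0 ≠ 0 := chord_ne_zero (by omega)
    have h1 : chord (2 * 2 ^ lam) (n t₀) ≠ 0 := by
      have := (n t₀).2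
      exact chord_ne_zero (by omega)
    have : x = (chord (2 * 2 ^ lam) (n t₀) / chord (2 * 2 ^ lam) 0 * ((u t₀ : ℂˣ) : ℂ)) •
        chordVector (0 : T → Fin (2 ^ lam)) (fun t => u t / u t₀) := by
      funext i
      by_cases hi : i ∈ T
      · have := chordVector_apply (0 : T → Fin (2 ^ lam)) (fun t => u t / u t₀) ⟨i, hi⟩
        dsimp only at this
        rw [Pi.smul_apply, this, hnu ⟨i, hi⟩, hc ⟨i, hi⟩ t₀]
        simp
        field_simp
      · simp [chordVector, hi, hzero i hi]
    rw [this, fadeSubspace_smul (mul_ne_zero (div_ne_zero h1 h0) (Units.ne_zero _))]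

lemma ncard_fadeSubspacesOfSupport (lam : ℕ) {nA nB : ℕ} {T : Finset (Fin nA ⊕ Fin nB)}
    (hT : T.Nonempty) :
    (fadeSubspacesOfSupport (pskSet (2 * 2 ^ lam)) T).Finite ∧
      ((fadeSubspacesOfSupport (pskSet (2 * 2 ^ lam)) T).ncard : ℚ) =
        ((2 ^ lam) ^ T.card - 2 ^ lam + 1) * (2 * 2 ^ lam) ^ (T.card - 1) := by
  classical
  obtain ⟨i₀, hi₀⟩ := hT
  set t₀ : T := ⟨i₀, hi₀⟩
  have hne : Nonempty T := ⟨t₀⟩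
  have hne' : NeZero (2 * 2 ^ lam) := ⟨by positivity⟩
  let : Fintype (rootsOfUnity (2 * 2 ^ lam) ℂ) := Fintype.ofFinite _
  set U : Finset (T → rootsOfUnity (2 * 2 ^ lam) ℂ) :=
    Fintype.piFinset fun t => if t = t₀ then {1} else Finset.univ with hU
  have hmemU : ∀ u, u ∈ U ↔ u t₀ = 1 := by
    intro u
    rw [hU, Fintype.mem_piFinset]
    constructor
    · intro h
      simpa using h t₀
    · intro h t
      split_ifs with ht
      · simp [ht, h]
      · exact Finset.mem_univ _
  have hcardU : U.card = (2 * 2 ^ lam) ^ (T.card - 1) := by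
    rw [hU, Fintype.card_piFinset, ← Finset.mul_prod_erase _ _ (Finset.mem_univ t₀)]
    rw [Finset.prod_congr rfl (g := fun _ => 2 * 2 ^ lam)]
    · simp [Finset.card_erase_of_mem]
    · intro t ht
      rw [if_neg (Finset.ne_of_mem_erase ht), Finset.card_univ, ← Nat.card_eq_fintype_card,
        Complex.card_rootsOfUnity]
  have himage : fadeSubspacesOfSupport (pskSet (2 * 2 ^ lam)) T =
      (fun p : (T → Fin (2 ^ lam)) × (T → rootsOfUnity (2 * 2 ^ lam) ℂ) =>
        fadeSubspace (chordVector p.1 p.2)) '' (normalizedModuli T (2 ^ lam) ×ˢ U : Finset _) := by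
    ext f
    constructor
    · rintro ⟨x, hx, hxT, rfl⟩
      obtain ⟨n, hn, u, hu, h⟩ := exists_chordVector t₀ hx hxT
      exact ⟨(n, u), by simp [hn, (hmemU u).2 hu], h.symm⟩
    · rintro ⟨⟨n, u⟩, -, rfl⟩
      exact ⟨_, chordVector_mem_diffVectors (by positivity) n u, chordVector_ne_zero_iff n u, rfl⟩
  rw [himage]
  refine ⟨(Finset.finite_toSet _).image _, ?_⟩
  rw [Set.InjOn.ncard_image, Set.ncard_coe_finset, Finset.card_product, hcardU]
  · push_cast
    rw [card_normalizedModuli]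
    simp
  · rintro ⟨n, u⟩ hp ⟨n', u'⟩ hp' heq
    simp only [Finset.coe_product, Set.mem_prod, Finset.mem_coe, hmemU] at hp hp'
    obtain ⟨c, -, hc⟩ := exists_smul_of_fadeSubspace_eq heq
    obtain ⟨rfl, rfl⟩ := eq_of_chordVector_eq_smul t₀ hp.1 hp'.1 hp.2 hp'.2 hc
    rfl

/-! ### Summation over supports -/

open Classical in
/-- The support of a stacked vector. -/
noncomputable def vecSupport {nA nB : ℕ} (x : Fin nA ⊕ Fin nB → ℂ) : Finset (Fin nA ⊕ Fin nB) :=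
  {i | x i ≠ 0}

lemma mem_vecSupport {nA nB : ℕ} {x : Fin nA ⊕ Fin nB → ℂ} {i : Fin nA ⊕ Fin nB} :
    i ∈ vecSupport x ↔ x i ≠ 0 := by
  simp [vecSupport]

lemma vecSupport_smul {nA nB : ℕ} {c : ℂ} (hc : c ≠ 0) (x : Fin nA ⊕ Fin nB → ℂ) :
    vecSupport (c • x) = vecSupport x := by
  ext i
  simp [mem_vecSupport, hc]

lemma vecSupport_eq_of_fadeSubspace_eq {nA nB : ℕ} {x y : Fin nA ⊕ Fin nB → ℂ}
    (h : fadeSubspace x = fadeSubspace y) : vecSupport x = vecSupport y := by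
  obtain ⟨c, hc, rfl⟩ := exists_smul_of_fadeSubspace_eq h
  exact vecSupport_smul hc y

lemma mem_fadeSubspacesOfSupport {S : Set ℂ} {nA nB : ℕ} {T : Finset (Fin nA ⊕ Fin nB)}
    {f : Submodule ℂ (Fin nA ⊕ Fin nB → ℂ)} :
    f ∈ fadeSubspacesOfSupport S T ↔
      ∃ x ∈ diffVectors S nA nB, vecSupport x = T ∧ f = fadeSubspace x := by
  simp only [fadeSubspacesOfSupport, Set.mem_ofPred_eq, Finset.ext_iff, mem_vecSupport]

/-- The number of singular fade subspaces with a given support of size `k ≥ 1`. -/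
def supportCount (lam k : ℕ) : ℚ :=
  ((2 ^ lam) ^ k - 2 ^ lam + 1) * (2 * 2 ^ lam) ^ (k - 1)

lemma ncard_biUnion_fadeSubspacesOfSupport (lam : ℕ) {nA nB : ℕ}
    (𝒯 : Finset (Finset (Fin nA ⊕ Fin nB))) (h𝒯 : ∀ T ∈ 𝒯, T.Nonempty) :
    (⋃ T ∈ 𝒯, fadeSubspacesOfSupport (pskSet (2 * 2 ^ lam)) T).Finite ∧
      ((⋃ T ∈ 𝒯, fadeSubspacesOfSupport (pskSet (2 * 2 ^ lam)) T).ncard : ℚ) =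
        ∑ T ∈ 𝒯, supportCount lam T.card := by
  classical
  induction 𝒯 using Finset.induction_on with
  | empty => simp
  | insert T 𝒯 hT ih =>
    obtain ⟨hfin, hcard⟩ := ih fun T' hT' => h𝒯 T' (Finset.mem_insert_of_mem hT')
    obtain ⟨hfin', hcard'⟩ :=
      ncard_fadeSubspacesOfSupport lam (h𝒯 T (Finset.mem_insert_self _ _))
    rw [Finset.set_biUnion_insert, Finset.sum_insert hT]
    refine ⟨hfin'.union hfin, ?_⟩
    rw [Set.ncard_union_eq ?_ hfin' hfin, Nat.cast_add, hcard, hcard', supportCount]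
    rw [Set.disjoint_left]
    intro f hf hf'
    simp only [Set.mem_iUnion] at hf'
    obtain ⟨T', hT', hf'⟩ := hf'
    obtain ⟨x, -, rfl, rfl⟩ := mem_fadeSubspacesOfSupport.1 hf
    obtain ⟨y, -, rfl, hxy⟩ := mem_fadeSubspacesOfSupport.1 hf'
    exact hT (vecSupport_eq_of_fadeSubspace_eq hxy ▸ hT')

lemma mem_biUnion_fadeSubspacesOfSupport {S : Set ℂ} {nA nB : ℕ}
    {𝒯 : Finset (Finset (Fin nA ⊕ Fin nB))} {f : Submodule ℂ (Fin nA ⊕ Fin nB → ℂ)} :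
    f ∈ (⋃ T ∈ 𝒯, fadeSubspacesOfSupport S T) ↔
      ∃ x ∈ diffVectors S nA nB, vecSupport x ∈ 𝒯 ∧ f = fadeSubspace x := by
  simp only [Set.mem_iUnion, mem_fadeSubspacesOfSupport]
  constructor
  · rintro ⟨T, hT, x, hx, rfl, rfl⟩
    exact ⟨x, hx, hT, rfl⟩
  · rintro ⟨x, hx, hT, rfl⟩
    exact ⟨_, hT, x, hx, rfl, rfl⟩

/-- The supports contained in the `A`-part. -/
def supportsA (nA nB : ℕ) : Finset (Finset (Fin nA ⊕ Fin nB)) :=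
  (Finset.univ.map Function.Embedding.inl).powerset

/-- The supports contained in the `B`-part. -/
def supportsB (nA nB : ℕ) : Finset (Finset (Fin nA ⊕ Fin nB)) :=
  (Finset.univ.map Function.Embedding.inr).powerset

lemma vecSupport_mem_supportsA {nA nB : ℕ} {x : Fin nA ⊕ Fin nB → ℂ} :
    vecSupport x ∈ supportsA nA nB ↔ partB x = 0 := by
  simp [supportsA, Finset.subset_iff, mem_vecSupport, funext_iff, partB]

lemma vecSupport_mem_supportsB {nA nB : ℕ} {x : Fin nA ⊕ Fin nB → ℂ} :
    vecSupport x ∈ supportsB nA nB ↔ partA x = 0 := by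
  simp [supportsB, Finset.subset_iff, mem_vecSupport, funext_iff, partA]

lemma vecSupport_eq_empty {nA nB : ℕ} {x : Fin nA ⊕ Fin nB → ℂ} :
    vecSupport x = ∅ ↔ x = 0 := by
  simp [Finset.ext_iff, mem_vecSupport, funext_iff]

lemma supportsA_inter_supportsB (nA nB : ℕ) : supportsA nA nB ∩ supportsB nA nB = {∅} := by
  ext T
  simp only [supportsA, supportsB, Finset.mem_inter, Finset.mem_powerset, Finset.mem_singleton]
  constructor
  · rintro ⟨h1, h2⟩
    refine Finset.eq_empty_of_forall_notMem fun i hi => ?_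
    have h1' := h1 hi
    have h2' := h2 hi
    rcases i with i | i <;> simp at h1' h2'
  · rintro rfl
    simp

lemma sum_supportsA (nA nB : ℕ) (g : ℕ → ℚ) :
    ∑ T ∈ supportsA nA nB, g T.card = ∑ k ∈ Finset.range (nA + 1), (nA.choose k : ℚ) * g k := by
  simp [supportsA, Finset.sum_powerset_apply_card]

lemma sum_supportsB (nA nB : ℕ) (g : ℕ → ℚ) :
    ∑ T ∈ supportsB nA nB, g T.card = ∑ k ∈ Finset.range (nB + 1), (nB.choose k : ℚ) * g k := by
  simp [supportsB, Finset.sum_powerset_apply_card]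

lemma sum_range_choose_extend {n N : ℕ} (h : n ≤ N) (g : ℕ → ℚ) :
    ∑ k ∈ Finset.range (n + 1), (n.choose k : ℚ) * g k =
      ∑ k ∈ Finset.range (N + 1), (n.choose k : ℚ) * g k := by
  refine Finset.sum_subset (Finset.range_mono (by omega)) fun k _ hk => ?_
  rw [Nat.choose_eq_zero_of_lt (by simpa using hk)]
  simp

lemma sum_supportsA_union_supportsB (nA nB : ℕ) (g : ℕ → ℚ) (hg : g 0 = 0) :
    ∑ T ∈ supportsA nA nB ∪ supportsB nA nB, g T.card =
      ∑ T ∈ supportsA nA nB, g T.card + ∑ T ∈ supportsB nA nB, g T.card := by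
  rw [← Finset.sum_union_inter, supportsA_inter_supportsB]
  simp [hg]

/-- The one-block supports are subtracted from all supports. The empty set belongs to both blocks'
families, and `hg` makes this double subtraction harmless. -/
lemma sum_compl_supports (nA nB : ℕ) (g : ℕ → ℚ) (hg : g 0 = 0) :
    ∑ T ∈ (supportsA nA nB ∪ supportsB nA nB)ᶜ, g T.card =
      ∑ k ∈ Finset.Icc 2 (nA + nB),
        (((nA + nB).choose k : ℚ) - (nA.choose k : ℚ) - (nB.choose k : ℚ)) * g k := by
  have h1 := Finset.sum_add_sum_compl (supportsA nA nB ∪ supportsB nA nB)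
    fun T : Finset (Fin nA ⊕ Fin nB) => g T.card
  have h2 : ∑ T : Finset (Fin nA ⊕ Fin nB), g T.card =
      ∑ k ∈ Finset.range (nA + nB + 1), ((nA + nB).choose k : ℚ) * g k := by
    rw [← Finset.powerset_univ, Finset.sum_powerset_apply_card]
    simp
  rw [sum_supportsA_union_supportsB nA nB g hg, sum_supportsA, sum_supportsB, h2,
    sum_range_choose_extend (Nat.le_add_right nA nB), sum_range_choose_extend
    (Nat.le_add_left nB nA)] at h1
  have h3 : ∑ T ∈ (supportsA nA nB ∪ supportsB nA nB)ᶜ, g T.card =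
      ∑ k ∈ Finset.range (nA + nB + 1),
        (((nA + nB).choose k : ℚ) - (nA.choose k : ℚ) - (nB.choose k : ℚ)) * g k := by
    simp only [sub_mul, Finset.sum_sub_distrib]
    linarith
  rw [h3]
  symm
  refine Finset.sum_subset (fun k hk => ?_) fun k hk hk' => ?_
  · simp only [Finset.mem_Icc, Finset.mem_range] at *
    omega
  · simp only [Finset.mem_Icc, Finset.mem_range] at *
    -- At k = 1 the bracket vanishes: every singleton lies in one block.
    have : k = 0 ∨ k = 1 := by omega
    rcases this with rfl | rfl
    · simp [hg]
    · simp

/-- Since the subspace determines the support, one representative meeting both blocks excludes any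
representative confined to one. -/
lemma removable_eq_biUnion (S : Set ℂ) (nA nB : ℕ) :
    removable S nA nB =
      ⋃ T ∈ (supportsA nA nB ∪ supportsB nA nB)ᶜ, fadeSubspacesOfSupport S T := by
  ext f
  rw [mem_biUnion_fadeSubspacesOfSupport]
  simp only [Finset.mem_compl, Finset.mem_union, vecSupport_mem_supportsA,
    vecSupport_mem_supportsB]
  constructor
  · rintro ⟨⟨x, hx, rfl⟩, h⟩
    exact ⟨x, hx, fun h' => h ⟨x, hx, h'.symm, rfl⟩, rfl⟩
  · rintro ⟨x, hx, h, rfl⟩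
    refine ⟨⟨x, hx, rfl⟩, ?_⟩
    rintro ⟨y, -, hy, hxy⟩
    have := vecSupport_eq_of_fadeSubspace_eq hxy
    rw [← vecSupport_mem_supportsA, ← vecSupport_mem_supportsB, this, vecSupport_mem_supportsA,
      vecSupport_mem_supportsB] at h
    exact h hy.symm

lemma ncard_setOf_ne_zero {nA nB : ℕ} (x : Fin nA ⊕ Fin nB → ℂ) :
    {i | x i ≠ 0}.ncard = (vecSupport x).card := by
  rw [← Set.ncard_coe_finset]
  congr 1
  ext i
  simp [mem_vecSupport]

lemma removableOfWeight_eq_biUnion (S : Set ℂ) (nA nB k : ℕ) :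
    removableOfWeight S nA nB k =
      ⋃ T ∈ (supportsA nA nB ∪ supportsB nA nB)ᶜ.filter (fun T => T.card = k),
        fadeSubspacesOfSupport S T := by
  ext f
  simp only [removableOfWeight, removable_eq_biUnion, Set.mem_ofPred_eq,
    mem_biUnion_fadeSubspacesOfSupport, ncard_setOf_ne_zero]
  constructor
  · rintro ⟨⟨x, hx, hxT, rfl⟩, y, -, rfl, hxy⟩
    exact ⟨x, hx, Finset.mem_filter.2 ⟨hxT, by rw [vecSupport_eq_of_fadeSubspace_eq hxy]⟩, rfl⟩
  · rintro ⟨x, hx, hxT, rfl⟩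
    obtain ⟨h1, h2⟩ := Finset.mem_filter.1 hxT
    exact ⟨⟨x, hx, h1, rfl⟩, x, hx, h2, rfl⟩

lemma nontrivialNonRemovable_eq_biUnion (S : Set ℂ) (nA nB : ℕ) :
    nontrivialNonRemovable S nA nB =
      ⋃ T ∈ (supportsA nA nB ∪ supportsB nA nB).erase ∅, fadeSubspacesOfSupport S T := by
  ext f
  rw [mem_biUnion_fadeSubspacesOfSupport]
  simp only [Finset.mem_erase, Finset.mem_union, vecSupport_mem_supportsA,
    vecSupport_mem_supportsB, ne_eq, vecSupport_eq_empty]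
  constructor
  · rintro ⟨⟨x, hx, h, rfl⟩, h0⟩
    exact ⟨x, hx, ⟨fun h' => h0 (by rw [h']), h.symm⟩, rfl⟩
  · rintro ⟨x, hx, ⟨h0, h⟩, rfl⟩
    refine ⟨⟨x, hx, h.symm, rfl⟩, fun h' => h0 ?_⟩
    rw [← vecSupport_eq_empty, vecSupport_eq_of_fadeSubspace_eq h', vecSupport_eq_empty]

lemma nonempty_of_mem_compl_supports {nA nB : ℕ} {T : Finset (Fin nA ⊕ Fin nB)}
    (hT : T ∈ (supportsA nA nB ∪ supportsB nA nB)ᶜ) : T.Nonempty := by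
  rw [Finset.nonempty_iff_ne_empty]
  rintro rfl
  simp [supportsA] at hT

lemma sum_range_eq_sum_Icc_one (n : ℕ) (g : ℕ → ℚ) (hg : g 0 = 0) :
    ∑ k ∈ Finset.range (n + 1), (n.choose k : ℚ) * g k =
      ∑ k ∈ Finset.Icc 1 n, (n.choose k : ℚ) * g k := by
  symm
  refine Finset.sum_subset (fun k hk => ?_) fun k hk hk' => ?_
  · simp only [Finset.mem_Icc, Finset.mem_range] at *
    omega
  · simp only [Finset.mem_Icc, Finset.mem_range] at *
    obtain rfl : k = 0 := by omega
    simp [hg]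

end TwoWayRelay

theorem lemma3 (lam : ℕ) (hlam : 1 ≤ lam) (M : ℕ) (hM : M = 2 ^ lam) (nA nB : ℕ) :
    ((TwoWayRelay.nontrivialNonRemovable (TwoWayRelay.pskSet M) nA nB).Finite ∧
      ((TwoWayRelay.nontrivialNonRemovable (TwoWayRelay.pskSet M) nA nB).ncard : ℚ) =
        ∑ k ∈ Finset.Icc 1 nA,
          (nA.choose k : ℚ) * (((M : ℚ) / 2) ^ k - (M : ℚ) / 2 + 1) * (M : ℚ) ^ (k - 1) +
        ∑ l ∈ Finset.Icc 1 nB,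
          (nB.choose l : ℚ) * (((M : ℚ) / 2) ^ l - (M : ℚ) / 2 + 1) * (M : ℚ) ^ (l - 1)) ∧
    (∀ k : ℕ, 2 ≤ k → k ≤ nA + nB →
      (TwoWayRelay.removableOfWeight (TwoWayRelay.pskSet M) nA nB k).Finite ∧
      ((TwoWayRelay.removableOfWeight (TwoWayRelay.pskSet M) nA nB k).ncard : ℚ) =
        (((nA + nB).choose k : ℚ) - (nA.choose k : ℚ) - (nB.choose k : ℚ)) *
          (((M : ℚ) / 2) ^ k - (M : ℚ) / 2 + 1) * (M : ℚ) ^ (k - 1)) ∧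
    ((TwoWayRelay.removable (TwoWayRelay.pskSet M) nA nB).Finite ∧
      ((TwoWayRelay.removable (TwoWayRelay.pskSet M) nA nB).ncard : ℚ) =
        ∑ k ∈ Finset.Icc 2 (nA + nB),
          (((nA + nB).choose k : ℚ) - (nA.choose k : ℚ) - (nB.choose k : ℚ)) *
            (((M : ℚ) / 2) ^ k - (M : ℚ) / 2 + 1) * (M : ℚ) ^ (k - 1)) := by
  obtain ⟨l, rfl⟩ : ∃ l, lam = l + 1 := ⟨lam - 1, by omega⟩
  obtain rfl : M = 2 * 2 ^ l := by rw [hM, pow_succ']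
  have hterm : ∀ (r : ℚ) (k : ℕ),
      r * ((((2 * 2 ^ l : ℕ) : ℚ) / 2) ^ k - ((2 * 2 ^ l : ℕ) : ℚ) / 2 + 1) *
        ((2 * 2 ^ l : ℕ) : ℚ) ^ (k - 1) = r * TwoWayRelay.supportCount l k := by
    intro r k
    have h2 : ((2 * 2 ^ l : ℕ) : ℚ) / 2 = 2 ^ l := by
      push_cast
      ring
    rw [h2, TwoWayRelay.supportCount]
    push_cast
    ring
  simp only [hterm]
  -- `supportCount l 0` is 2 - 2^l, with no counting meaning, so the value at the empty support is
  -- reset to 0.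
  set g : ℕ → ℚ := fun k => if k = 0 then 0 else TwoWayRelay.supportCount l k
  have hg0 : g 0 = 0 := rfl
  have hg : ∀ k, 1 ≤ k → g k = TwoWayRelay.supportCount l k := fun k hk => if_neg (by omega)
  have hIcc : ∀ n : ℕ, ∑ k ∈ Finset.Icc 1 n, (n.choose k : ℚ) * g k =
      ∑ k ∈ Finset.Icc 1 n, (n.choose k : ℚ) * TwoWayRelay.supportCount l k := fun n =>
    Finset.sum_congr rfl fun k hk => by rw [hg k (Finset.mem_Icc.1 hk).1]
  refine ⟨?_, ?_, ?_⟩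
  · rw [TwoWayRelay.nontrivialNonRemovable_eq_biUnion]
    obtain ⟨hfin, hcard⟩ := TwoWayRelay.ncard_biUnion_fadeSubspacesOfSupport l
      ((TwoWayRelay.supportsA nA nB ∪ TwoWayRelay.supportsB nA nB).erase ∅)
      (fun T hT => Finset.nonempty_iff_ne_empty.2 (Finset.ne_of_mem_erase hT))
    refine ⟨hfin, ?_⟩
    rw [hcard, Finset.sum_congr rfl (g := fun T => g T.card), Finset.sum_erase,
      TwoWayRelay.sum_supportsA_union_supportsB nA nB g hg0, TwoWayRelay.sum_supportsA,
      TwoWayRelay.sum_supportsB, TwoWayRelay.sum_range_eq_sum_Icc_one nA g hg0,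
      TwoWayRelay.sum_range_eq_sum_Icc_one nB g hg0, hIcc, hIcc]
    · simp [hg0]
    · intro T hT
      exact (hg _ (Finset.card_pos.2 (Finset.nonempty_iff_ne_empty.2
        (Finset.ne_of_mem_erase hT)))).symm
  · intro k hk hk'
    rw [TwoWayRelay.removableOfWeight_eq_biUnion]
    obtain ⟨hfin, hcard⟩ := TwoWayRelay.ncard_biUnion_fadeSubspacesOfSupport l
      ((TwoWayRelay.supportsA nA nB ∪ TwoWayRelay.supportsB nA nB)ᶜ.filter fun T => T.card = k)
      (fun T hT => TwoWayRelay.nonempty_of_mem_compl_supports (Finset.mem_of_mem_filter T hT))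
    refine ⟨hfin, ?_⟩
    -- An indicator of size k isolates the single term of weight k; it vanishes at 0 because k ≥ 2.
    have := TwoWayRelay.sum_compl_supports nA nB
      (fun j => if j = k then TwoWayRelay.supportCount l j else 0) (if_neg (by omega))
    rw [hcard, Finset.sum_filter, this]
    simp [Finset.sum_ite_eq', hk, hk']
  · rw [TwoWayRelay.removable_eq_biUnion]
    obtain ⟨hfin, hcard⟩ := TwoWayRelay.ncard_biUnion_fadeSubspacesOfSupport l
      (TwoWayRelay.supportsA nA nB ∪ TwoWayRelay.supportsB nA nB)ᶜ
      (fun T hT => TwoWayRelay.nonempty_of_mem_compl_supports hT)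
    refine ⟨hfin, ?_⟩
    rw [hcard, Finset.sum_congr rfl (g := fun T => g T.card),
      TwoWayRelay.sum_compl_supports nA nB g hg0]
    · refine Finset.sum_congr rfl fun k hk => ?_
      rw [hg k (by have := (Finset.mem_Icc.1 hk).1; omega)]
    · intro T hT
      exact (hg _ (Finset.card_pos.2 (TwoWayRelay.nonempty_of_mem_compl_supports hT))).symm
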